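/- Let $\mathcal H_q$ be a quaternionic Hilbert space, that is, a right vector space over the quaternions $\mathbb H$ with an inner product $\langle\cdot,\cdot\rangle\colon \mathcal H_q\times\mathcal H_q\to\mathbb H$ satisfying $\langle u,v\cdot q+w\rangle=\langle u,v\rangle q+\langle u,w\rangle$, $\langle v,w\rangle=\langle w,v\rangle^*$, $\langle v,v\rangle\ge 0$, and $\langle v,v\rangle=0$ only if $v=0$, which is complete for the norm $\|v\|=\sqrt{\langle v,v\rangle}$. Let $\mathrm B(\mathcal H_q)_{\mathrm{sa}}$ be the real vector space of bounded right $\mathbb H$-linear self-adjoint operators on $\mathcal H_q$. For $T\in\mathrm B(\mathcal H_q)_{\mathrm{sa}}$ let $\sigma(T)$ be the set of all $\lambda\in\mathbb R$ such that $T-\lambda I$ has no inverse in $\mathrm B(\mathcal H_q)_{\mathrm{sa}}$, and order $\mathrm B(\mathcal H_q)_{\mathrm{sa}}$ by $S\le T$ if and only if $\sigma(T-S)\subseteq[0,\infty)$. For $A\subseteq \mathrm B(\mathcal H_q)_{\mathrm{sa}}$ let $A^{\mathrm u}$ be the set of upper bounds of $A$ in $\mathrm B(\mathcal H_q)_{\mathrm{sa}}$,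 and call $S,T\in\mathrm B(\mathcal H_q)_{\mathrm{sa}}$ disjoint if $\{S+T,-S-T\}^{\mathrm u}=\{S-T,-S+T\}^{\mathrm u}$. Proposition. There are no non-zero disjoint operators in $\mathrm B(\mathcal H_q)_{\mathrm{sa}}$: if $S,T\in\mathrm B(\mathcal H_q)_{\mathrm{sa}}$ are both non-zero, then $S$ and $T$ are not disjoint. -/

import Mathlib

open scoped Quaternion

/-- A quaternionic inner product space: a right vector space over the quaternions `ℍ[ℝ]`
(that is, a module over `ℍ[ℝ]ᵐᵒᵖ`, with `v · q = MulOpposite.op q • v`) with an `ℍ[ℝ]`-valued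
inner product, conjugate symmetric and right linear in the second variable, whose norm is
`‖v‖ = √⟨v, v⟩`. The last axiom contains that `⟨v, v⟩` is a non-negative real and, as the norm is
definite, that `⟨v, v⟩ = 0` only for `v = 0`. A quaternionic Hilbert space is a complete one. -/
class QuaternionicInnerProductSpace (H : Type*) [NormedAddCommGroup H] extends
    Module ℍ[ℝ]ᵐᵒᵖ H, Inner ℍ[ℝ] H where
  inner_add_right : ∀ u v w : H, inner u (v + w) = inner u v + inner u w
  inner_smul_right : ∀ (u v : H) (q : ℍ[ℝ]),
    inner u (MulOpposite.op q • v) = inner u v * q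
  star_inner : ∀ v w : H, star (inner w v) = inner v w
  inner_self : ∀ v : H, inner v v = ((‖v‖ ^ 2 : ℝ) : ℍ[ℝ])

namespace QuaternionicInnerProductSpace

section

variable {H : Type*} [NormedAddCommGroup H] [QuaternionicInnerProductSpace H]

theorem inner_smul_left (v w : H) (q : ℍ[ℝ]) :
    inner ℍ[ℝ] (MulOpposite.op q • v) w = star q * inner ℍ[ℝ] v w := by
  rw [← star_inner, inner_smul_right, star_mul, star_inner]

theorem inner_add_left (u v w : H) :
    inner ℍ[ℝ] (u + v) w = inner ℍ[ℝ] u w + inner ℍ[ℝ] v w := by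
  rw [← star_inner, inner_add_right, star_add, star_inner, star_inner]

theorem inner_zero_left (w : H) : inner ℍ[ℝ] (0 : H) w = 0 := by
  simpa using inner_smul_left (0 : H) w 0

theorem inner_zero_right (w : H) : inner ℍ[ℝ] w (0 : H) = 0 := by
  simpa using inner_smul_right w (0 : H) 0

theorem norm_op_smul (v : H) (q : ℍ[ℝ]) : ‖MulOpposite.op q • v‖ = ‖q‖ * ‖v‖ := by
  have h := inner_self (MulOpposite.op q • v)
  rw [inner_smul_right, inner_smul_left, inner_self, mul_assoc,
    (Quaternion.coe_commutes (‖v‖ ^ 2) q), ← mul_assoc, Quaternion.star_mul_self,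
    ← Quaternion.coe_mul, Quaternion.coe_inj, Quaternion.normSq_eq_norm_mul_self] at h
  rw [← sq_eq_sq₀ (norm_nonneg _) (by positivity), ← h]
  ring

end

/-- The real scalar multiplication `r • v = v · r`. -/
noncomputable instance (H : Type*) [NormedAddCommGroup H] [QuaternionicInnerProductSpace H] :
    NormedSpace ℝ H where
  __ := Module.compHom H (algebraMap ℝ ℍ[ℝ]ᵐᵒᵖ)
  norm_smul_le r v := by
    change ‖MulOpposite.op (r : ℍ[ℝ]) • v‖ ≤ _
    rw [norm_op_smul, Quaternion.norm_coe]

instance (H : Type*) [NormedAddCommGroup H] [QuaternionicInnerProductSpace H] :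
    IsScalarTower ℝ ℍ[ℝ]ᵐᵒᵖ H where
  smul_assoc r q v := by
    change (r • q) • v = algebraMap ℝ ℍ[ℝ]ᵐᵒᵖ r • (q • v)
    rw [Algebra.smul_def, mul_smul]

theorem real_smul_eq {H : Type*} [NormedAddCommGroup H] [QuaternionicInnerProductSpace H]
    (r : ℝ) (v : H) : r • v = MulOpposite.op (r : ℍ[ℝ]) • v := rfl

end QuaternionicInnerProductSpace

/-- `B(H)`: the bounded (equivalently, continuous) right `ℍ[ℝ]`-linear operators on `H`. -/
abbrev QuaternionicOperator (H : Type*) [NormedAddCommGroup H]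
    [QuaternionicInnerProductSpace H] : Type _ :=
  H →L[ℍ[ℝ]ᵐᵒᵖ] H

/-- `S` is the adjoint of `T`: `⟨w, T v⟩ = ⟨S w, v⟩` for all `v`, `w`. By definiteness of the inner
product there is at most one such `S`. -/
def IsQuaternionicAdjoint {H : Type*} [NormedAddCommGroup H] [QuaternionicInnerProductSpace H]
    (T S : QuaternionicOperator H) : Prop :=
  ∀ v w : H, inner ℍ[ℝ] w (T v) = inner ℍ[ℝ] (S w) v

/-- `B(H)_sa`: the real vector space of bounded self-adjoint operators. -/
def QuaternionicSelfAdjoint (H : Type*) [NormedAddCommGroup H]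
    [QuaternionicInnerProductSpace H] : Submodule ℝ (QuaternionicOperator H) where
  carrier := {T | IsQuaternionicAdjoint T T}
  add_mem' {S T} hS hT v w := by
    simp [QuaternionicInnerProductSpace.inner_add_right,
      QuaternionicInnerProductSpace.inner_add_left, hS v w, hT v w]
  zero_mem' v w := by
    simp [QuaternionicInnerProductSpace.inner_zero_right,
      QuaternionicInnerProductSpace.inner_zero_left]
  smul_mem' r T hT v w := by
    simp only [_root_.smul_apply, QuaternionicInnerProductSpace.real_smul_eq,
      QuaternionicInnerProductSpace.inner_smul_right,
      QuaternionicInnerProductSpace.inner_smul_left, hT v w, Quaternion.star_coe]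
    exact (Quaternion.coe_commutes r _).symm

/-- The spectrum of a self-adjoint operator: the real `r` for which `T - r I` has no inverse
in `B(H)_sa`. -/
def quaternionicSpectrum {H : Type*} [NormedAddCommGroup H] [QuaternionicInnerProductSpace H]
    (T : QuaternionicSelfAdjoint H) : Set ℝ :=
  {r | ¬ ∃ S : QuaternionicSelfAdjoint H,
    ((T : QuaternionicOperator H) - r • 1) * (S : QuaternionicOperator H) = 1 ∧
    (S : QuaternionicOperator H) * ((T : QuaternionicOperator H) - r • 1) = 1}

/-- The cone of `B(H)_sa`: the self-adjoint operators with non-negative spectrum. -/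
def quaternionicPositiveCone (H : Type*) [NormedAddCommGroup H]
    [QuaternionicInnerProductSpace H] : Set (QuaternionicSelfAdjoint H) :=
  {T | quaternionicSpectrum T ⊆ Set.Ici 0}

/-- The set `Aᵘ` of upper bounds of `A` for the order `x ≤ y ↔ y - x ∈ K`. -/
def coneUpperBounds {X : Type*} [AddCommGroup X] (K A : Set X) : Set X :=
  {z | ∀ a ∈ A, z - a ∈ K}

/-- Disjointness in the space `X` ordered by the cone `K`:
`{x + y, -x - y}ᵘ = {x - y, -x + y}ᵘ`. In a vector lattice this says `|x + y| = |x - y|`,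
that is, `|x| ⊓ |y| = 0`. -/
def ConeDisjoint {X : Type*} [AddCommGroup X] (K : Set X) (x y : X) : Prop :=
  coneUpperBounds K {x + y, -x - y} = coneUpperBounds K {x - y, -x + y}

/-!
The argument works with the real quadratic form `x ↦ ⟪x, T x⟫` of a self-adjoint operator `T`,
where `⟪v, w⟫` is the real part of the quaternionic inner product.

The order is the one given by quadratic forms (`mem_quaternionicPositiveCone_iff`). If the form of
`T` is non-negative and `r < 0`, then `T - r` is coercive, hence invertible by Lax–Milgram;
conversely, the infimum of the form over the unit sphere lies in the spectrum, since a non-negative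
invertible operator has a form bounded below on the unit sphere.

The upper bounds of `{A, -A}` determine the absolute value of the form of `A`: at a unit vector `x`,
the infimum of `⟪x, Z x⟫` over the upper bounds `Z` is `|⟪x, A x⟫|`. Indeed, if `P` is the
projection onto the line `x · ℍ`, then `(|⟪x, A x⟫| + ε) P + M (1 - P)` is an upper bound as soon
as `M` is large enough (`exists_upperBound_inner_eq`).

Consequently, if `S` and `T` are disjoint, the forms of `S + T` and `S - T` have the same absolute
value, which says that `⟪x, S x⟫ ⟪x, T x⟫ = 0` for all `x`. A product of two quadratic
forms vanishes only if one of them does, and a self-adjoint operator with zero form is zero.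
-/

namespace QuaternionicInnerProductSpace

variable {H : Type*} [NormedAddCommGroup H] [QuaternionicInnerProductSpace H]

/-! ### The underlying real inner product space -/

/-- The real inner product `⟪v, w⟫ = Re ⟨v, w⟩`, inducing the given norm. -/
noncomputable instance : InnerProductSpace ℝ H where
  inner v w := (inner ℍ[ℝ] v w).re
  norm_sq_eq_re_inner v := by
    rw [inner_self, Quaternion.re_coe, RCLike.re_to_real]
  conj_inner_symm v w := by
    rw [← star_inner v w]; simp
  add_left u v w := by simp [inner_add_left]
  smul_left v w r := by
    rw [real_smul_eq, inner_smul_left]; simp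

theorem real_inner_eq_re (v w : H) : inner ℝ v w = (inner ℍ[ℝ] v w).re := rfl

/-- The projection `v ↦ x · ⟨x, v⟩` onto the line spanned by a unit vector `x`. -/
noncomputable def lineProj (x : H) (hx : ‖x‖ = 1) : QuaternionicOperator H where
  toFun v := MulOpposite.op (inner ℍ[ℝ] x v) • x
  map_add' v w := by simp [inner_add_right, add_smul]
  map_smul' q v := by
    obtain ⟨q, rfl⟩ := MulOpposite.op_surjective q
    simp [inner_smul_right, mul_smul]
  cont := by
    let f : H →+ H :=
      { toFun := fun v => MulOpposite.op (inner ℍ[ℝ] x v) • x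
        map_zero' := by simp [inner_zero_right]
        map_add' := fun v w => by simp [inner_add_right, add_smul] }
    refine AddMonoidHomClass.continuous_of_bound f 1 fun v => ?_
    have h1 : inner ℝ v (f v) = ‖f v‖ ^ 2 := by
      change (inner ℍ[ℝ] v (MulOpposite.op (inner ℍ[ℝ] x v) • x)).re = _
      change _ = ‖MulOpposite.op (inner ℍ[ℝ] x v) • x‖ ^ 2
      rw [norm_op_smul, hx, inner_smul_right, ← star_inner v x, Quaternion.star_mul_self,
        Quaternion.normSq_eq_norm_mul_self, Quaternion.re_coe]
      ring
    have h2 := real_inner_le_norm v (f v)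
    rw [h1] at h2
    rcases (norm_nonneg (f v)).eq_or_lt with h | h
    · rw [← h]; positivity
    · nlinarith

theorem norm_inv_norm_smul {v : H} (hv : v ≠ 0) : ‖‖v‖⁻¹ • v‖ = 1 := by
  rw [norm_smul, norm_inv, norm_norm, inv_mul_cancel₀ (norm_ne_zero_iff.mpr hv)]

theorem lineProj_apply (x : H) (hx : ‖x‖ = 1) (v : H) :
    lineProj x hx v = MulOpposite.op (inner ℍ[ℝ] x v) • x := rfl

theorem norm_lineProj_apply (x : H) (hx : ‖x‖ = 1) (v : H) :
    ‖lineProj x hx v‖ = ‖inner ℍ[ℝ] x v‖ := by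
  rw [lineProj_apply, norm_op_smul, hx, mul_one]

theorem lineProj_self (x : H) (hx : ‖x‖ = 1) : lineProj x hx x = x := by
  simp [lineProj_apply, inner_self, hx]

theorem isQuaternionicAdjoint_lineProj (x : H) (hx : ‖x‖ = 1) :
    IsQuaternionicAdjoint (lineProj x hx) (lineProj x hx) := by
  intro v w
  rw [lineProj_apply, lineProj_apply, inner_smul_right, inner_smul_left, star_inner]

theorem real_inner_lineProj (x : H) (hx : ‖x‖ = 1) (v : H) :
    inner ℝ v (lineProj x hx v) = ‖lineProj x hx v‖ ^ 2 := by
  rw [norm_lineProj_apply, real_inner_eq_re, lineProj_apply, inner_smul_right, ← star_inner v x,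
    Quaternion.star_mul_self, Quaternion.normSq_eq_norm_mul_self, Quaternion.re_coe, sq]

end QuaternionicInnerProductSpace

open QuaternionicInnerProductSpace

namespace QuaternionicSelfAdjoint

variable {H : Type*} [NormedAddCommGroup H] [QuaternionicInnerProductSpace H]

/-! ### Quadratic forms of self-adjoint operators -/

theorem real_inner_apply (T : QuaternionicSelfAdjoint H) (v w : H) :
    inner ℝ w (T.1 v) = inner ℝ (T.1 w) v := by
  rw [real_inner_eq_re, real_inner_eq_re, T.2 v w]

theorem real_inner_add_apply_add (T : QuaternionicSelfAdjoint H) (v w : H) :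
    inner ℝ (v + w) (T.1 (v + w)) =
      inner ℝ v (T.1 v) + 2 * inner ℝ w (T.1 v) + inner ℝ w (T.1 w) := by
  have h : inner ℝ v (T.1 w) = inner ℝ w (T.1 v) := by
    rw [real_inner_apply, real_inner_comm]
  rw [map_add, _root_.inner_add_left, _root_.inner_add_right, _root_.inner_add_right, h]
  ring

theorem real_inner_smul_apply_smul (T : QuaternionicSelfAdjoint H) (r : ℝ) (v : H) :
    inner ℝ (r • v) (T.1 (r • v)) = r ^ 2 * inner ℝ v (T.1 v) := by
  have h : T.1 (r • v) = r • T.1 v := by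
    rw [real_smul_eq, real_smul_eq, map_smul]
  rw [h, real_inner_smul_left, _root_.real_inner_smul_right]
  ring

/-- The form of a self-adjoint operator is also homogeneous for quaternionic scalars, because
`⟨v, T v⟩` is real and hence central. -/
theorem real_inner_op_smul_apply_op_smul (T : QuaternionicSelfAdjoint H) (q : ℍ[ℝ]) (v : H) :
    inner ℝ (MulOpposite.op q • v) (T.1 (MulOpposite.op q • v)) =
      ‖q‖ ^ 2 * inner ℝ v (T.1 v) := by
  have hstar : star (inner ℍ[ℝ] v (T.1 v)) = inner ℍ[ℝ] v (T.1 v) := by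
    rw [star_inner, ← T.2 v v]
  obtain ⟨a, ha⟩ : ∃ a : ℝ, inner ℍ[ℝ] v (T.1 v) = (a : ℍ[ℝ]) :=
    ⟨_, Quaternion.star_eq_self.mp hstar⟩
  rw [real_inner_eq_re, real_inner_eq_re, map_smul, QuaternionicInnerProductSpace.inner_smul_right,
    QuaternionicInnerProductSpace.inner_smul_left, ha, mul_assoc, Quaternion.coe_commutes,
    ← mul_assoc, Quaternion.star_mul_self, ← Quaternion.coe_mul, Quaternion.re_coe,
    Quaternion.re_coe, Quaternion.normSq_eq_norm_mul_self, sq]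

theorem exists_norm_apply_le (T : QuaternionicOperator H) :
    ∃ C > 0, ∀ v : H, ‖T v‖ ≤ C * ‖v‖ :=
  (T.restrictScalars ℝ).bound

theorem eq_zero_of_forall_real_inner_eq_zero (T : QuaternionicSelfAdjoint H)
    (h : ∀ v : H, inner ℝ v (T.1 v) = 0) : T = 0 := by
  refine Subtype.ext (ContinuousLinearMap.ext fun v => ?_)
  have h1 := real_inner_add_apply_add T v (T.1 v)
  rw [h, h, h] at h1
  have h2 : inner ℝ (T.1 v) (T.1 v) = 0 := by linarith
  simpa using h2

/-- If the product of the quadratic forms of two self-adjoint operators vanishes, so does one of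
the operators. -/
theorem eq_zero_or_eq_zero_of_forall_mul_eq_zero (S T : QuaternionicSelfAdjoint H)
    (h : ∀ v : H, inner ℝ v (S.1 v) * inner ℝ v (T.1 v) = 0) : S = 0 ∨ T = 0 := by
  by_contra! hne
  obtain ⟨x, hx⟩ := not_forall.mp (mt (eq_zero_of_forall_real_inner_eq_zero S) hne.1)
  obtain ⟨y, hy⟩ := not_forall.mp (mt (eq_zero_of_forall_real_inner_eq_zero T) hne.2)
  have hTx := (mul_eq_zero.mp (h x)).resolve_left hx
  have hSy := (mul_eq_zero.mp (h y)).resolve_right hy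
  -- On the line `x + t y` the product is the polynomial `t (a + 2 s t) (2 r + b t)`.
  have key (t : ℝ) : (inner ℝ x (S.1 x) + 2 * (t * inner ℝ y (S.1 x))) *
      (2 * (t * inner ℝ y (T.1 x)) + t ^ 2 * inner ℝ y (T.1 y)) = 0 := by
    have := h (x + t • y)
    rw [real_inner_add_apply_add, real_inner_add_apply_add, real_inner_smul_apply_smul,
      real_inner_smul_apply_smul, hTx, hSy, real_inner_smul_left, real_inner_smul_left] at this
    linarith
  generalize inner ℝ x (S.1 x) = a at *
  generalize inner ℝ y (T.1 y) = b at *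
  generalize inner ℝ y (S.1 x) = s at *
  generalize inner ℝ y (T.1 x) = r at *
  have k1 := key 1
  have k2 := key (-1)
  have k3 := key 2
  have har : a * r = 0 := by linarith [key (-2)]
  have hr : r = 0 := (mul_eq_zero.mp har).resolve_left hx
  have hab : a * b = 0 := by subst hr; linarith
  exact (mul_ne_zero hx hy) hab

/-! ### Positivity in terms of the quadratic form -/

/-- Lax–Milgram: a coercive self-adjoint operator is invertible, and the inverse is
quaternion linear and self-adjoint. -/
theorem exists_inverse_of_coercive [CompleteSpace H] (U : QuaternionicSelfAdjoint H) {c : ℝ}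
    (hc : 0 < c) (h : ∀ v : H, c * ‖v‖ ^ 2 ≤ inner ℝ v (U.1 v)) :
    ∃ R : QuaternionicSelfAdjoint H, U.1 * R.1 = 1 ∧ R.1 * U.1 = 1 := by
  let B : H →L[ℝ] H →L[ℝ] ℝ := (innerSL ℝ).comp (U.1.restrictScalars ℝ)
  have hB (v w : H) : B v w = inner ℝ (U.1 v) w := rfl
  have hcoer : IsCoercive B := by
    refine ⟨c, hc, fun v => ?_⟩
    rw [hB, real_inner_comm]
    linarith [h v]
  let e := hcoer.continuousLinearEquivOfBilin
  have he (v : H) : e v = U.1 v :=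
    ext_inner_right ℝ fun w => by
      rw [hcoer.continuousLinearEquivOfBilin_apply, hB]
  have hU (v : H) : U.1 (e.symm v) = v := by rw [← he, e.apply_symm_apply]
  have hU' (v : H) : e.symm (U.1 v) = v := by rw [← he, e.symm_apply_apply]
  let R : QuaternionicOperator H :=
    { toFun := e.symm
      map_add' := map_add e.symm
      map_smul' := fun q v => by
        apply e.injective
        rw [e.apply_symm_apply, he, RingHom.id_apply, map_smul, hU]
      cont := e.symm.continuous }
  refine ⟨⟨R, fun v w => ?_⟩, ContinuousLinearMap.ext hU, ContinuousLinearMap.ext hU'⟩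
  change inner ℍ[ℝ] w (e.symm v) = inner ℍ[ℝ] (e.symm w) v
  rw [← hU w, hU', ← U.2, hU]

/-- The square of a non-negative operator is dominated by a multiple of the operator. -/
theorem norm_apply_sq_le (U : QuaternionicSelfAdjoint H) {C : ℝ} (hC : 0 < C)
    (hbound : ∀ v : H, ‖U.1 v‖ ≤ C * ‖v‖) (h : ∀ v : H, 0 ≤ inner ℝ v (U.1 v)) (v : H) :
    ‖U.1 v‖ ^ 2 ≤ C * inner ℝ v (U.1 v) := by
  -- The form is non-negative at `v - t U v`; the upper bound `⟪v, U v⟫ - 2 t ‖U v‖ ^ 2 + t ^ 2 C ‖U v‖ ^ 2`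
  -- of its value there is smallest for `t = C⁻¹`.
  have h1 := h (v + (-C⁻¹) • U.1 v)
  rw [real_inner_add_apply_add, real_inner_smul_apply_smul, real_inner_smul_left,
    real_inner_self_eq_norm_sq] at h1
  have h2 : inner ℝ (U.1 v) (U.1 (U.1 v)) ≤ C * ‖U.1 v‖ ^ 2 := by
    nlinarith [real_inner_le_norm (U.1 v) (U.1 (U.1 v)), hbound (U.1 v), norm_nonneg (U.1 v)]
  have h3 : (-C⁻¹) ^ 2 * inner ℝ (U.1 v) (U.1 (U.1 v)) ≤ C⁻¹ * ‖U.1 v‖ ^ 2 :=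
    calc _ ≤ (-C⁻¹) ^ 2 * (C * ‖U.1 v‖ ^ 2) := by gcongr
      _ = _ := by field_simp
  have h4 : C⁻¹ * ‖U.1 v‖ ^ 2 ≤ inner ℝ v (U.1 v) := by linarith
  rwa [inv_mul_le_iff₀ hC] at h4

theorem isQuaternionicAdjoint_one :
    IsQuaternionicAdjoint (1 : QuaternionicOperator H) 1 := fun _ _ => rfl

/-- The self-adjoint operator `T - r I`. -/
noncomputable def subScalar (T : QuaternionicSelfAdjoint H) (r : ℝ) : QuaternionicSelfAdjoint H :=
  T - r • ⟨1, isQuaternionicAdjoint_one⟩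

theorem coe_subScalar (T : QuaternionicSelfAdjoint H) (r : ℝ) :
    (subScalar T r).1 = T.1 - r • 1 := rfl

theorem real_inner_subScalar (T : QuaternionicSelfAdjoint H) (r : ℝ) (v : H) :
    inner ℝ v ((subScalar T r).1 v) = inner ℝ v (T.1 v) - r * ‖v‖ ^ 2 := by
  have : (subScalar T r).1 v = T.1 v - r • v := rfl
  rw [this, _root_.inner_sub_right, _root_.real_inner_smul_right, real_inner_self_eq_norm_sq]

/-- The order on `B(H)_sa` defined by the spectrum is the one defined by quadratic forms. -/
theorem mem_quaternionicPositiveCone_iff [CompleteSpace H] (T : QuaternionicSelfAdjoint H) :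
    T ∈ quaternionicPositiveCone H ↔ ∀ v : H, 0 ≤ inner ℝ v (T.1 v) := by
  constructor
  · intro hT
    by_contra! hneg
    obtain ⟨v₀, hv₀⟩ := hneg
    have hv₀' : v₀ ≠ 0 := by rintro rfl; simp at hv₀
    obtain ⟨C, hC, hCb⟩ := exists_norm_apply_le T.1
    let s : Set ℝ := (fun v : H => inner ℝ v (T.1 v)) '' {v | ‖v‖ = 1}
    have hbdd : BddBelow s := by
      refine ⟨-C, ?_⟩
      rintro _ ⟨v, hv : ‖v‖ = 1, rfl⟩
      have h1 := abs_real_inner_le_norm v (T.1 v)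
      have h2 := hCb v
      rw [hv] at h1 h2
      change -C ≤ inner ℝ v (T.1 v)
      linarith [neg_abs_le (inner ℝ v (T.1 v))]
    have hmem (v : H) (hv : v ≠ 0) : (‖v‖⁻¹) ^ 2 * inner ℝ v (T.1 v) ∈ s :=
      ⟨‖v‖⁻¹ • v, norm_inv_norm_smul hv, real_inner_smul_apply_smul T _ v⟩
    have hm : sInf s < 0 := (csInf_le hbdd (hmem v₀ hv₀')).trans_lt
      (mul_neg_of_pos_of_neg (by positivity) hv₀)
    -- The infimum `m` of the form over the unit sphere is negative, so `T - m` has an inverse.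
    have hinv : ∃ R : QuaternionicSelfAdjoint H,
        (T.1 - sInf s • 1) * R.1 = 1 ∧ R.1 * (T.1 - sInf s • 1) = 1 := by
      by_contra hno
      exact absurd (hT hno) (not_le.mpr hm)
    obtain ⟨R, -, hR⟩ := hinv
    rw [← coe_subScalar] at hR
    set U := subScalar T (sInf s) with hUdef
    have hUnonneg (v : H) : 0 ≤ inner ℝ v (U.1 v) := by
      rcases eq_or_ne v 0 with rfl | hv
      · simp
      have h1 := csInf_le hbdd (hmem v hv)
      rw [hUdef, real_inner_subScalar, sub_nonneg]
      have hpos : 0 < ‖v‖ ^ 2 := by positivity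
      rwa [inv_pow, ← div_eq_inv_mul, le_div_iff₀ hpos] at h1
    obtain ⟨D, hD, hDb⟩ := exists_norm_apply_le U.1
    obtain ⟨K, hK, hKb⟩ := exists_norm_apply_le R.1
    have hlow (v : H) (hv : ‖v‖ = 1) : 1 / (K ^ 2 * D) ≤ inner ℝ v (U.1 v) := by
      have h1 : R.1 (U.1 v) = v := congrArg (fun A : QuaternionicOperator H => A v) hR
      have h2 := hKb (U.1 v)
      rw [h1, hv] at h2
      have h3 := norm_apply_sq_le U hD hDb hUnonneg v
      rw [div_le_iff₀ (by positivity)]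
      calc (1 : ℝ) ≤ (K * ‖U.1 v‖) ^ 2 := one_le_pow₀ h2
        _ = K ^ 2 * ‖U.1 v‖ ^ 2 := by ring
        _ ≤ K ^ 2 * (D * inner ℝ v (U.1 v)) := by gcongr
        _ = _ := by ring
    have hle : sInf s + 1 / (K ^ 2 * D) ≤ sInf s := by
      refine le_csInf ⟨_, hmem v₀ hv₀'⟩ ?_
      rintro _ ⟨v, hv : ‖v‖ = 1, rfl⟩
      have h1 := hlow v hv
      rw [hUdef, real_inner_subScalar, hv] at h1
      change _ ≤ inner ℝ v (T.1 v)
      linarith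
    have : 0 < 1 / (K ^ 2 * D) := by positivity
    linarith
  · intro h r hr
    by_contra hneg
    rw [Set.mem_Ici, not_le] at hneg
    refine hr (exists_inverse_of_coercive (subScalar T r) (neg_pos.mpr hneg) fun v => ?_)
    rw [real_inner_subScalar]
    linarith [h v]

/-! ### Upper bounds of an operator and its negative -/

/-- At a unit vector `x`, some upper bound of `A` and `-A` has a form exceeding `|⟪x, A x⟫|` by an
arbitrarily small amount. -/
theorem exists_upperBound_inner_eq [CompleteSpace H] (A : QuaternionicSelfAdjoint H) {x : H}
    (hx : ‖x‖ = 1) {ε : ℝ} (hε : 0 < ε) :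
    ∃ Z ∈ coneUpperBounds (quaternionicPositiveCone H) {A, -A},
      inner ℝ x (Z.1 x) = |inner ℝ x (A.1 x)| + ε := by
  obtain ⟨C, hC, hCb⟩ := exists_norm_apply_le A.1
  set a := |inner ℝ x (A.1 x)| with ha
  -- With `p = P v` and `w = v - P v`, the mixed term `2 C ‖p‖ ‖w‖` in the bound for the form of `A` is at most
  -- `ε ‖p‖ ^ 2 + (C ^ 2 / ε) ‖w‖ ^ 2`, and the form of `A` at `w` is at most `C ‖w‖ ^ 2`.
  set M := C ^ 2 / ε + C with hM
  let Q : QuaternionicSelfAdjoint H := ⟨lineProj x hx, isQuaternionicAdjoint_lineProj x hx⟩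
  let Z : QuaternionicSelfAdjoint H := subScalar ((a + ε - M) • Q) (-M)
  have hQ (v : H) : inner ℝ v (((a + ε - M) • Q).1 v) = (a + ε - M) * ‖lineProj x hx v‖ ^ 2 := by
    rw [← real_inner_lineProj, ← _root_.real_inner_smul_right]
    rfl
  have hZ (v : H) :
      inner ℝ v (Z.1 v) = (a + ε - M) * ‖lineProj x hx v‖ ^ 2 + M * ‖v‖ ^ 2 := by
    rw [real_inner_subScalar, hQ]
    ring
  have hbound (v : H) : |inner ℝ v (A.1 v)| ≤ inner ℝ v (Z.1 v) := by
    rw [hZ]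
    set p := lineProj x hx v with hp
    obtain ⟨w, hv⟩ : ∃ w, v = p + w := ⟨v - p, by abel⟩
    have hpw : inner ℝ p w = 0 := by
      have h1 := real_inner_lineProj x hx v
      rw [← hp, hv, _root_.inner_add_left, real_inner_self_eq_norm_sq, real_inner_comm] at h1
      linarith
    have hnorm : ‖p + w‖ ^ 2 = ‖p‖ ^ 2 + ‖w‖ ^ 2 := by
      rw [norm_add_sq_real, hpw]
      ring
    have hpp : |inner ℝ p (A.1 p)| = a * ‖p‖ ^ 2 := by
      rw [hp, norm_lineProj_apply, lineProj_apply, real_inner_op_smul_apply_op_smul, abs_mul,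
        abs_of_nonneg (sq_nonneg _), mul_comm]
    have hwp : |inner ℝ w (A.1 p)| ≤ C * ‖p‖ * ‖w‖ :=
      calc _ ≤ ‖w‖ * ‖A.1 p‖ := abs_real_inner_le_norm _ _
        _ ≤ ‖w‖ * (C * ‖p‖) := by gcongr; exact hCb p
        _ = _ := by ring
    have hww : |inner ℝ w (A.1 w)| ≤ C * ‖w‖ ^ 2 :=
      calc _ ≤ ‖w‖ * ‖A.1 w‖ := abs_real_inner_le_norm _ _
        _ ≤ ‖w‖ * (C * ‖w‖) := by gcongr; exact hCb w
        _ = _ := by ring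
    have hmixed : 2 * (C * ‖p‖ * ‖w‖) ≤ ε * ‖p‖ ^ 2 + C ^ 2 / ε * ‖w‖ ^ 2 := by
      have h1 : ε * ‖p‖ ^ 2 + C ^ 2 / ε * ‖w‖ ^ 2 - 2 * (C * ‖p‖ * ‖w‖) =
          (ε * ‖p‖ - C * ‖w‖) ^ 2 / ε := by
        field_simp
        ring
      have h2 : 0 ≤ (ε * ‖p‖ - C * ‖w‖) ^ 2 / ε := by positivity
      linarith
    rw [hv, real_inner_add_apply_add, hnorm]
    have htri : |inner ℝ p (A.1 p) + 2 * inner ℝ w (A.1 p) + inner ℝ w (A.1 w)| ≤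
        |inner ℝ p (A.1 p)| + 2 * |inner ℝ w (A.1 p)| + |inner ℝ w (A.1 w)| := by
      refine (abs_add_three _ _ _).trans_eq ?_
      rw [abs_mul, abs_two]
    rw [hM]
    linarith
  refine ⟨Z, ?_, ?_⟩
  · rintro B (rfl | rfl) <;> rw [mem_quaternionicPositiveCone_iff] <;> intro v
    · have h1 : (Z - B).1 v = Z.1 v - B.1 v := rfl
      rw [h1, _root_.inner_sub_right]
      linarith [hbound v, le_abs_self (inner ℝ v (B.1 v))]
    · have h1 : (Z - -A).1 v = Z.1 v - -A.1 v := rfl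
      rw [h1, _root_.inner_sub_right, _root_.inner_neg_right]
      linarith [hbound v, neg_abs_le (inner ℝ v (A.1 v))]
  · rw [hZ, lineProj_self, hx]
    ring

theorem abs_real_inner_le_of_mem_coneUpperBounds [CompleteSpace H]
    {A Z : QuaternionicSelfAdjoint H}
    (hZ : Z ∈ coneUpperBounds (quaternionicPositiveCone H) {A, -A}) (v : H) :
    |inner ℝ v (A.1 v)| ≤ inner ℝ v (Z.1 v) := by
  have h1 := (mem_quaternionicPositiveCone_iff _).mp (hZ A (Or.inl rfl)) v
  have h2 := (mem_quaternionicPositiveCone_iff _).mp (hZ (-A) (Or.inr rfl)) v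
  have e1 : (Z - A).1 v = Z.1 v - A.1 v := rfl
  have e2 : (Z - -A).1 v = Z.1 v - -A.1 v := rfl
  rw [e1, _root_.inner_sub_right] at h1
  rw [e2, _root_.inner_sub_right, _root_.inner_neg_right] at h2
  exact abs_le.mpr ⟨by linarith, by linarith⟩

theorem abs_real_inner_le_of_coneUpperBounds_subset [CompleteSpace H]
    {A B : QuaternionicSelfAdjoint H}
    (h : coneUpperBounds (quaternionicPositiveCone H) {A, -A} ⊆
      coneUpperBounds (quaternionicPositiveCone H) {B, -B}) {x : H} (hx : ‖x‖ = 1) :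
    |inner ℝ x (B.1 x)| ≤ |inner ℝ x (A.1 x)| := by
  refine le_of_forall_pos_le_add fun ε hε => ?_
  obtain ⟨Z, hZ, hZx⟩ := exists_upperBound_inner_eq A hx hε
  rw [← hZx]
  exact abs_real_inner_le_of_mem_coneUpperBounds (h hZ) x

end QuaternionicSelfAdjoint

open QuaternionicSelfAdjoint

theorem mainTheorem7 {H : Type*} [NormedAddCommGroup H] [QuaternionicInnerProductSpace H]
    [CompleteSpace H] (S T : QuaternionicSelfAdjoint H) (hS : S ≠ 0) (hT : T ≠ 0) :
    ¬ ConeDisjoint (quaternionicPositiveCone H) S T := by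
  intro h
  have e1 : -S - T = -(S + T) := by abel
  have e2 : -S + T = -(S - T) := by abel
  rw [ConeDisjoint, e1, e2] at h
  have hunit (x : H) (hx : ‖x‖ = 1) : inner ℝ x (S.1 x) * inner ℝ x (T.1 x) = 0 := by
    have habs : |inner ℝ x ((S + T).1 x)| = |inner ℝ x ((S - T).1 x)| :=
      le_antisymm (abs_real_inner_le_of_coneUpperBounds_subset h.ge hx)
        (abs_real_inner_le_of_coneUpperBounds_subset h.le hx)
    have f1 : (S + T).1 x = S.1 x + T.1 x := rfl
    have f2 : (S - T).1 x = S.1 x - T.1 x := rfl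
    rw [f1, f2, _root_.inner_add_right, _root_.inner_sub_right, ← sq_eq_sq_iff_abs_eq_abs] at habs
    linarith
  have hall (x : H) : inner ℝ x (S.1 x) * inner ℝ x (T.1 x) = 0 := by
    rcases eq_or_ne x 0 with rfl | hx
    · simp
    have h1 := hunit (‖x‖⁻¹ • x) (norm_inv_norm_smul hx)
    rw [real_inner_smul_apply_smul, real_inner_smul_apply_smul] at h1
    have hne : ‖x‖⁻¹ ^ 2 ≠ 0 := by positivity
    rcases mul_eq_zero.mp h1 with h2 | h2
    · rw [(mul_eq_zero.mp h2).resolve_left hne, zero_mul]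
    · rw [(mul_eq_zero.mp h2).resolve_left hne, mul_zero]
  rcases eq_zero_or_eq_zero_of_forall_mul_eq_zero S T hall with h0 | h0
  · exact hS h0
  · exact hT h0
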